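/- For every integer $n \ge 2$ there are constants $0<\delta_n(\tau)<1$, one for each $\tau\in(0,\tfrac12]$ and depending only on $n$ and $\tau$, such that the following holds with $C_n=(4n)^{5n}$. Let $|\cdot|$ denote outer Lebesgue measure on $\mathbb{R}^n$, and for $A\subset\mathbb{R}^n$ and $t\in[0,1]$ put $$D(A;t)=tA+(1-t)A=\{ta_1+(1-t)a_2 : a_1,a_2\in A\},\qquad \delta(A;t)=|D(A;t)\setminus A|.$$ Let $\tau\in(0,\tfrac12]$ and $t\in[\tau,1-\tau]$, let $T\subset\mathbb{R}^n$ be a (closed, $n$-dimensional) simplex with $|T|=1$, and let $A\subset T$ be a Lebesgue measurable set that contains all vertices of $T$ and satisfies $|A|=1-\delta$ with $0<\delta\le\delta_n(\tau)$. Then $$|T\setminus A|\le C_n\,\tau^{-1}\,\delta(A;t).$$ -/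

import Mathlib

open MeasureTheory
open scoped ENNReal Pointwise

/-- The interpolated sumset `D(A;t) = tA + (1-t)A = {t a₁ + (1-t) a₂ | a₁, a₂ ∈ A}`. -/
def interpolatedSumset {n : ℕ} (A : Set (EuclideanSpace ℝ (Fin n))) (t : ℝ) :
    Set (EuclideanSpace ℝ (Fin n)) :=
  t • A + (1 - t) • A

/-- The quantity `δ(A;t) = |D(A;t) \ A|`, where `|·|` is the outer Lebesgue measure (the value of
`volume` on an arbitrary set is its outer measure; `D(A;t)` need not be measurable). -/
noncomputable def sumsetExcess {n : ℕ} (A : Set (EuclideanSpace ℝ (Fin n))) (t : ℝ) : ℝ≥0∞ :=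
  volume (interpolatedSumset A t \ A)

/-!
Work in barycentric coordinates `x_v` of the simplex `T`, and write `B = T \ A`, `ε = δ(A;t)`.
By the symmetry `t ↔ 1 - t` assume `t ≤ 1 / 2`.

*Moving towards a vertex.* Let `s = t ^ k` and let `v` be a vertex. The point `(1 - s) y + s v` is
obtained from `v` by applying `ψ ↦ (1 - t) y + t ψ` a total of `k` times. So if `y ∈ A` but
`(1 - s) y + s v ∉ A`, some intermediate point falls in `D(A;t) \ A`. The set `E_v` of such `y` has
measure at most `k 2 ^ n ε` (`homothety_mem_of_forall_notMem`,
`measure_iUnion_preimage_homothety_le`).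

*Interior.* If `|B|` is small enough in terms of `t` and `η`, all points with coordinates greater
than `η` belong to `D(A;t)` (`mem_interpolatedSumset_of_lt_coord`), so they contribute at most `ε` to
`|B|`.

*Boundary layer.* A point `x` with some coordinate at most `η` satisfies
`∑_v (x_v - s)₊ ≥ 1 - n s - η`. Integrate this over the layer in `B` and substitute
`x = (1 - s) y + s v` in the term of `v`: the weight becomes `(1 - s) y_v`, the Jacobian is
`(1 - s) ^ n`, and `x ∈ B` forces `y ∈ B` or `y ∈ E_v`. As `∑_v y_v = 1`, this gives
(`measure_near_boundary_le`)
`(1 - n s - η) |B ∩ layer| ≤ (1 - s) ^ (n + 1) (|B| + ∑_v |E_v|)`.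
For `s ≤ 1 / (2 n (n + 1))` and `η ≤ s / 8` the factor on the right is smaller than the one on the
left by at least `s / 8` (`one_sub_pow_succ_le`): the contraction comes from losing only `n s`, not
`(n + 1) s`, near a facet. Therefore `(s / 8) |B| ≤ (1 + (n + 1) k 2 ^ n) ε`.

*Constants.* There is a `k ≤ 2 n (n + 1)` with `t / (2 n (n + 1)) ≤ t ^ k ≤ 1 / (2 n (n + 1))`
(`exists_pow_mem_Icc`), which yields a bound well inside `(4 n) ^ (5 n) / τ` (`constant_le`).
-/

/-! ### Homotheties and Haar measure -/

section Homothety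

theorem homothety_leftInverse {V : Type*} [AddCommGroup V] [Module ℝ V] (p : V) {r : ℝ} (hr : r ≠ 0) :
    Function.LeftInverse (AffineMap.homothety p r⁻¹) (AffineMap.homothety p r) := by
  intro x
  rw [← AffineMap.comp_apply, ← AffineMap.homothety_mul, inv_mul_cancel₀ hr]
  simp

variable {E : Type*} [NormedAddCommGroup E] [NormedSpace ℝ E] [FiniteDimensional ℝ E]
  [MeasurableSpace E] [BorelSpace E]

theorem homothety_measurableEmbedding (p : E) {r : ℝ} (hr : r ≠ 0) :
    MeasurableEmbedding (AffineMap.homothety p r : E → E) :=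
  have : CompleteSpace E := FiniteDimensional.complete ℝ E
  (AffineMap.homothety_continuous p r).measurableEmbedding (homothety_leftInverse p hr).injective

theorem measure_preimage_homothety (μ : Measure E) [μ.IsAddHaarMeasure] (p : E) {r : ℝ}
    (hr : r ≠ 0) (S : Set E) :
    μ (AffineMap.homothety p r ⁻¹' S) =
      ENNReal.ofReal |(r⁻¹) ^ Module.finrank ℝ E| * μ S := by
  have h := homothety_leftInverse p (inv_ne_zero hr)
  rw [inv_inv] at h
  rw [← Measure.addHaar_image_homothety,
    ← Set.image_eq_preimage_of_inverse h (homothety_leftInverse p hr)]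

theorem map_homothety (μ : Measure E) [μ.IsAddHaarMeasure] (p : E) {r : ℝ} (hr : r ≠ 0) :
    μ.map (AffineMap.homothety p r) = ENNReal.ofReal |(r⁻¹) ^ Module.finrank ℝ E| • μ := by
  ext S hS
  rw [(homothety_measurableEmbedding p hr).map_apply, measure_preimage_homothety μ p hr]
  rfl

theorem lintegral_comp_homothety (μ : Measure E) [μ.IsAddHaarMeasure] (p : E) {r : ℝ}
    (hr : r ≠ 0) (F : E → ℝ≥0∞) :
    ∫⁻ y, F (AffineMap.homothety p r y) ∂μ =
      ENNReal.ofReal |(r⁻¹) ^ Module.finrank ℝ E| * ∫⁻ x, F x ∂μ := by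
  rw [← (homothety_measurableEmbedding p hr).lintegral_map, map_homothety μ p hr,
    lintegral_smul_measure, smul_eq_mul]

theorem lintegral_eq_lintegral_comp_homothety (μ : Measure E) [μ.IsAddHaarMeasure] (p : E)
    {r : ℝ} (hr : 0 < r) (F : E → ℝ≥0∞) :
    ∫⁻ x, F x ∂μ =
      ENNReal.ofReal (r ^ Module.finrank ℝ E) *
        ∫⁻ y, F (AffineMap.homothety p r y) ∂μ := by
  rw [lintegral_comp_homothety μ p hr.ne', ← mul_assoc,
    ← ENNReal.ofReal_mul (by positivity), abs_of_pos (by positivity), inv_pow,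
    mul_inv_cancel₀ (by positivity), ENNReal.ofReal_one, one_mul]

end Homothety

/-! ### Barycentric coordinates and interpolated sumsets -/

theorem AffineBasis.coord_homothety {ι V : Type*} [DecidableEq ι] [AddCommGroup V] [Module ℝ V]
    (b : AffineBasis ι ℝ V) (p : V) (r : ℝ) (y : V) (j : ι) :
    b.coord j (AffineMap.homothety p r y) = r * b.coord j y + (1 - r) * b.coord j p := by
  rw [AffineMap.homothety_eq_lineMap, AffineMap.apply_lineMap, AffineMap.lineMap_apply_ring]
  ring

theorem AffineBasis.mem_convexHull_iff {ι V : Type*} [AddCommGroup V] [Module ℝ V]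
    (b : AffineBasis ι ℝ V) (x : V) :
    x ∈ convexHull ℝ (Set.range b) ↔ ∀ i, 0 ≤ b.coord i x := by
  rw [b.convexHull_eq_nonneg_coord]; rfl

theorem mem_interpolatedSumset {n : ℕ} {A : Set (EuclideanSpace ℝ (Fin n))} {t : ℝ}
    {a b x : EuclideanSpace ℝ (Fin n)} (ha : a ∈ A) (hb : b ∈ A)
    (h : t • a + (1 - t) • b = x) : x ∈ interpolatedSumset A t :=
  ⟨_, ⟨a, ha, rfl⟩, _, ⟨b, hb, rfl⟩, h⟩

theorem interpolatedSumset_symm {n : ℕ} (A : Set (EuclideanSpace ℝ (Fin n))) (t : ℝ) :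
    interpolatedSumset A (1 - t) = interpolatedSumset A t := by
  rw [interpolatedSumset, interpolatedSumset, sub_sub_cancel, add_comm]

theorem interpolatedSumset_subset {n : ℕ} {A K : Set (EuclideanSpace ℝ (Fin n))} {t : ℝ}
    (hK : Convex ℝ K) (hA : A ⊆ K) (h0 : 0 ≤ t) (h1 : t ≤ 1) :
    interpolatedSumset A t ⊆ K := by
  rintro _ ⟨_, ⟨a, ha, rfl⟩, _, ⟨b, hb, rfl⟩, rfl⟩
  exact hK (hA ha) (hA hb) h0 (by linarith) (by ring)

/-! ### Filling the interior, and moving towards a vertex -/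

section Simplex

variable {n : ℕ} (b : AffineBasis (Fin (n + 1)) ℝ (EuclideanSpace ℝ (Fin n)))
  {A : Set (EuclideanSpace ℝ (Fin n))}

/-- Away from the boundary of the simplex the sumset is everything: for `y ∈ T` the points
`x + (1 - t) η (y - x)` and `x - t η (y - x)` lie in `T` and have weighted mean `x`, and each of them
misses `A` only for a small set of `y`, so some `y` puts both in `A`. -/
theorem mem_interpolatedSumset_of_lt_coord {t η : ℝ} (ht : 0 < t) (ht' : t ≤ 1 / 2)
    (hη : 0 < η) (hη' : η ≤ 1)
    (hT : volume (convexHull ℝ (Set.range b)) = 1)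
    (hB : 2 * volume (convexHull ℝ (Set.range b) \ A) < ENNReal.ofReal ((t * η) ^ n))
    {x : EuclideanSpace ℝ (Fin n)} (hx : ∀ j, η < b.coord j x) :
    x ∈ interpolatedSumset A t := by
  set T := convexHull ℝ (Set.range b)
  have hcoord : ∀ y ∈ T, ∀ j, b.coord j y ≤ 1 := by
    intro y hy j
    rw [← b.sum_coord_apply_eq_one y]
    exact Finset.single_le_sum (f := fun j => b.coord j y)
      (fun i _ => (b.mem_convexHull_iff y).1 hy i) (Finset.mem_univ j)
  have hmem1 : ∀ y ∈ T, AffineMap.homothety x ((1 - t) * η) y ∈ T := by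
    intro y hy
    refine (b.mem_convexHull_iff _).2 fun j => ?_
    rw [b.coord_homothety]
    have h0 := (b.mem_convexHull_iff y).1 hy j
    have h1 := hx j
    have : (1 - t) * η ≤ 1 := by nlinarith
    have h3 : 0 ≤ (1 - t) * η := by apply mul_nonneg <;> linarith
    have := mul_nonneg h3 h0
    have : 0 ≤ (1 - (1 - t) * η) * b.coord j x := by apply mul_nonneg <;> linarith
    linarith
  have hmem2 : ∀ y ∈ T, AffineMap.homothety x (-(t * η)) y ∈ T := by
    intro y hy
    refine (b.mem_convexHull_iff _).2 fun j => ?_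
    rw [b.coord_homothety]
    have h0 := hcoord y hy j
    have h1 := hx j
    have h3 : 0 ≤ t * η := by positivity
    nlinarith [mul_le_mul_of_nonneg_left h0 h3, mul_nonneg h3 (hη.le.trans h1.le)]
  have hvol : ∀ r : ℝ, t * η ≤ |r| → volume (AffineMap.homothety x r ⁻¹' (T \ A)) ≤
      (ENNReal.ofReal ((t * η) ^ n))⁻¹ * volume (T \ A) := by
    intro r hr
    have htη : 0 < t * η := by positivity
    have hr0 : r ≠ 0 := abs_pos.1 (htη.trans_le hr)
    rw [measure_preimage_homothety volume x hr0, finrank_euclideanSpace_fin,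
      ← ENNReal.ofReal_inv_of_pos (by positivity)]
    gcongr
    rw [abs_pow, abs_inv, inv_pow]
    gcongr
  by_contra hxD
  have hcov : T ⊆ AffineMap.homothety x ((1 - t) * η) ⁻¹' (T \ A) ∪
      AffineMap.homothety x (-(t * η)) ⁻¹' (T \ A) := by
    intro y hy
    by_contra hcon
    simp only [Set.mem_union, Set.mem_preimage, Set.mem_sdiff, hmem1 y hy, hmem2 y hy, true_and,
      not_or, not_not] at hcon
    refine hxD (mem_interpolatedSumset hcon.1 hcon.2 ?_)
    simp only [AffineMap.homothety_apply, vsub_eq_sub, vadd_eq_add]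
    module
  have h1 : (1 : ℝ≥0∞) ≤
      (ENNReal.ofReal ((t * η) ^ n))⁻¹ * (2 * volume (T \ A)) := by
    rw [← hT]
    refine (measure_mono hcov).trans ((measure_union_le _ _).trans ?_)
    rw [two_mul, mul_add]
    refine add_le_add (hvol _ ?_) (hvol _ ?_)
    · rw [abs_of_nonneg (by apply mul_nonneg <;> linarith)]
      gcongr
      linarith
    · rw [abs_neg]
      exact le_abs_self _
  have hc0 : ENNReal.ofReal ((t * η) ^ n) ≠ 0 := by
    rw [Ne, ENNReal.ofReal_eq_zero, not_le]; positivity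
  rw [mul_comm, ← div_eq_mul_inv, ENNReal.le_div_iff_mul_le (Or.inl hc0)
    (Or.inl ENNReal.ofReal_ne_top), one_mul] at h1
  exact absurd hB (not_lt.2 h1)

/-- Iterating `ψ ↦ (1 - t) y + t ψ` from a point `v` of `A` gives `y + t ^ j (v - y)`. Each of these
points lies in the sumset if its predecessor is in `A`, hence in `A` unless it lies in the excess. -/
theorem homothety_mem_of_forall_notMem {t : ℝ} {v y : EuclideanSpace ℝ (Fin n)}
    {G : Set (EuclideanSpace ℝ (Fin n))}
    (hv : v ∈ A) (hy : y ∈ A) (hG : interpolatedSumset A t \ A ⊆ G) (k : ℕ)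
    (h : ∀ j < k, AffineMap.homothety v (1 - t ^ (j + 1)) y ∉ G) :
    AffineMap.homothety v (1 - t ^ k) y ∈ A := by
  induction k with
  | zero => simpa using hv
  | succ k ih =>
    have hk := ih fun j hj => h j (hj.trans k.lt_succ_self)
    by_contra hcon
    refine h k k.lt_succ_self (hG ⟨mem_interpolatedSumset hk hy ?_, hcon⟩)
    simp only [AffineMap.homothety_apply, vsub_eq_sub, vadd_eq_add, pow_succ]
    module

theorem measure_iUnion_preimage_homothety_le {t : ℝ} (ht : 0 < t) (ht' : t ≤ 1 / 2)
    (v : EuclideanSpace ℝ (Fin n)) (G : Set (EuclideanSpace ℝ (Fin n))) (k : ℕ) :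
    volume (⋃ j ∈ Finset.range k, AffineMap.homothety v (1 - t ^ (j + 1)) ⁻¹' G) ≤
      ENNReal.ofReal (k * 2 ^ n) * volume G := by
  refine (measure_biUnion_finset_le _ _).trans ?_
  have hj : ∀ j ∈ Finset.range k, volume (AffineMap.homothety v (1 - t ^ (j + 1)) ⁻¹' G) ≤
      ENNReal.ofReal (2 ^ n) * volume G := by
    intro j _
    have h1 : t ^ (j + 1) ≤ 1 / 2 := by
      rw [pow_succ]
      have := pow_le_one₀ (n := j) ht.le (by linarith)
      nlinarith
    rw [measure_preimage_homothety volume v (by linarith), finrank_euclideanSpace_fin, abs_pow,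
      abs_inv, abs_of_pos (by linarith)]
    have h2 : (1 - t ^ (j + 1))⁻¹ ≤ 2 := by
      rw [inv_le_comm₀ (by linarith) (by norm_num)]
      linarith
    have h3 : 0 ≤ (1 - t ^ (j + 1))⁻¹ := inv_nonneg.2 (by linarith)
    gcongr
  refine (Finset.sum_le_sum hj).trans_eq ?_
  rw [Finset.sum_const, Finset.card_range, nsmul_eq_mul, ENNReal.ofReal_mul (by positivity),
    ENNReal.ofReal_natCast, mul_assoc]

end Simplex

/-! ### The averaging inequality near the boundary -/

/-- If one coordinate is negligible, the truncated weights `(x_v - s)₊` have total at least about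
`1 - n s`, one `s` better than the `1 - (n + 1) s` available at a general point. -/
theorem ofReal_le_sum_ofReal_coord_sub {n : ℕ}
    (b : AffineBasis (Fin (n + 1)) ℝ (EuclideanSpace ℝ (Fin n))) {s η : ℝ}
    {x : EuclideanSpace ℝ (Fin n)} (hx : ∃ j, b.coord j x ≤ η) :
    ENNReal.ofReal (1 - n * s - η) ≤ ∑ v, ENNReal.ofReal (b.coord v x - s) := by
  obtain ⟨j, hj⟩ := hx
  have hsum : ∑ v ∈ Finset.univ.erase j, (b.coord v x - s) = 1 - b.coord j x - n * s := by
    have h := b.sum_coord_apply_eq_one x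
    rw [← Finset.add_sum_erase _ _ (Finset.mem_univ j)] at h
    rw [Finset.sum_sub_distrib, Finset.sum_const, Finset.card_erase_of_mem (Finset.mem_univ j),
      Finset.card_univ, Fintype.card_fin, nsmul_eq_mul, Nat.add_sub_cancel]
    linarith
  calc ENNReal.ofReal (1 - n * s - η)
      ≤ ENNReal.ofReal (∑ v ∈ Finset.univ.erase j, (b.coord v x - s)) := by
        rw [hsum]
        exact ENNReal.ofReal_le_ofReal (by linarith)
    _ ≤ ENNReal.ofReal (∑ v ∈ Finset.univ.erase j, max (b.coord v x - s) 0) := by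
        gcongr
        exact le_max_left _ _
    _ = ∑ v ∈ Finset.univ.erase j, ENNReal.ofReal (b.coord v x - s) := by
        rw [ENNReal.ofReal_sum_of_nonneg fun _ _ => le_max_right _ _]
        simp
    _ ≤ ∑ v, ENNReal.ofReal (b.coord v x - s) :=
        Finset.sum_le_sum_of_subset (Finset.erase_subset _ _)

/-- Pointwise form of: a point `y + s (v - y)` outside `A` has `y ∉ A` or `y ∈ E`. The weight
`(x_v - s)₊` vanishes unless `y` lies on the positive side of the facet opposite `v`. -/
theorem indicator_comp_homothety_le {n : ℕ}
    (b : AffineBasis (Fin (n + 1)) ℝ (EuclideanSpace ℝ (Fin n)))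
    {A E : Set (EuclideanSpace ℝ (Fin n))} {s : ℝ} (hs : s < 1) (v : Fin (n + 1))
    (hE : ∀ y ∈ A, AffineMap.homothety (b v) (1 - s) y ∉ A → y ∈ E)
    (y : EuclideanSpace ℝ (Fin n)) :
    (convexHull ℝ (Set.range b) \ A).indicator (fun x => ENNReal.ofReal (b.coord v x - s))
        (AffineMap.homothety (b v) (1 - s) y) ≤
      ENNReal.ofReal (1 - s) *
        ((convexHull ℝ (Set.range b) \ A).indicator (fun x => ENNReal.ofReal (b.coord v x)) y +
          E.indicator 1 y) := by
  by_cases hx : AffineMap.homothety (b v) (1 - s) y ∈ convexHull ℝ (Set.range b) \ A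
  swap
  · rw [Set.indicator_of_notMem hx]
    exact zero_le
  have hval : b.coord v (AffineMap.homothety (b v) (1 - s) y) - s = (1 - s) * b.coord v y := by
    rw [b.coord_homothety, b.coord_apply_eq]
    ring
  rw [Set.indicator_of_mem hx, hval, ENNReal.ofReal_mul (by linarith)]
  gcongr
  rcases le_or_gt (b.coord v y) 0 with h0 | h0
  · rw [ENNReal.ofReal_of_nonpos h0]
    exact zero_le
  have hyT : y ∈ convexHull ℝ (Set.range b) := by
    refine (b.mem_convexHull_iff y).2 fun j => ?_
    by_cases hj : j = v
    · exact hj ▸ h0.le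
    · have h := (b.mem_convexHull_iff _).1 hx.1 j
      rw [b.coord_homothety, b.coord_apply_ne hj, mul_zero, add_zero] at h
      exact nonneg_of_mul_nonneg_right h (by linarith)
  by_cases hyA : y ∈ A
  · rw [Set.indicator_of_mem (hE y hyA hx.2), Pi.one_apply]
    refine le_add_left (ENNReal.ofReal_le_one.2 ?_)
    rw [← b.sum_coord_apply_eq_one y]
    exact Finset.single_le_sum (f := fun j => b.coord j y)
      (fun i _ => (b.mem_convexHull_iff y).1 hyT i) (Finset.mem_univ v)
  · rw [Set.indicator_of_mem (show y ∈ convexHull ℝ (Set.range b) \ A from ⟨hyT, hyA⟩)]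
    exact le_self_add

/-- Integrating the weights `(x_v - s)₊` over the part of `T \ A` near the boundary and substituting
`x = y + s (v - y)` turns them into `(1 - s) y_v`, which sum to `1 - s` over the vertices. -/
theorem measure_near_boundary_le {n : ℕ}
    (b : AffineBasis (Fin (n + 1)) ℝ (EuclideanSpace ℝ (Fin n)))
    {A : Set (EuclideanSpace ℝ (Fin n))} {E : Fin (n + 1) → Set (EuclideanSpace ℝ (Fin n))}
    {s : ℝ} (η : ℝ) (hs : s < 1) (hA : NullMeasurableSet A volume)
    (hEm : ∀ v, MeasurableSet (E v))
    (hE : ∀ v, ∀ y ∈ A, AffineMap.homothety (b v) (1 - s) y ∉ A → y ∈ E v) :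
    ENNReal.ofReal (1 - n * s - η) *
        volume ((convexHull ℝ (Set.range b) \ A) ∩ {x | ∃ j, b.coord j x ≤ η}) ≤
      ENNReal.ofReal ((1 - s) ^ (n + 1)) *
        (volume (convexHull ℝ (Set.range b) \ A) + ∑ v, volume (E v)) := by
  set B := convexHull ℝ (Set.range b) \ A with hB
  have hcoord : ∀ v, Measurable (b.coord v) := fun v => (continuous_barycentric_coord b v).measurable
  have hBm : NullMeasurableSet B volume :=
    ((Set.finite_range b).isCompact_convexHull (𝕜 := ℝ)).measurableSet.nullMeasurableSet.diff hA
  have hLm : MeasurableSet {x | ∃ j, b.coord j x ≤ η} := by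
    simp only [Set.ofPred_exists]
    exact MeasurableSet.iUnion fun j => measurableSet_le (hcoord j) measurable_const
  have hind : ∀ c v, AEMeasurable (B.indicator fun x => ENNReal.ofReal (b.coord v x - c)) :=
    fun c v => ((hcoord v).sub_const c).ennreal_ofReal.aemeasurable.indicator₀ hBm
  have hind0 : ∀ v, AEMeasurable (B.indicator fun x => ENNReal.ofReal (b.coord v x)) :=
    fun v => (hcoord v).ennreal_ofReal.aemeasurable.indicator₀ hBm
  -- The barycentric coordinates sum to one on the simplex.
  have hsum : ∑ v, ∫⁻ y, B.indicator (fun x => ENNReal.ofReal (b.coord v x)) y = volume B := by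
    rw [← lintegral_finsetSum' _ fun v _ => hind0 v, ← lintegral_indicator_one₀ hBm]
    congr 1 with y
    by_cases hy : y ∈ B
    · simp only [Set.indicator_of_mem hy, Pi.one_apply]
      rw [← ENNReal.ofReal_sum_of_nonneg fun v _ => (b.mem_convexHull_iff y).1 hy.1 v,
        b.sum_coord_apply_eq_one, ENNReal.ofReal_one]
    · simp [hy]
  calc ENNReal.ofReal (1 - n * s - η) * volume (B ∩ {x | ∃ j, b.coord j x ≤ η})
      = ∫⁻ x, (B ∩ {x | ∃ j, b.coord j x ≤ η}).indicator
          (fun _ => ENNReal.ofReal (1 - n * s - η)) x :=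
        (lintegral_indicator_const₀ (hBm.inter hLm.nullMeasurableSet) _).symm
    _ ≤ ∫⁻ x, ∑ v, B.indicator (fun x => ENNReal.ofReal (b.coord v x - s)) x := by
        refine lintegral_mono (Set.indicator_le fun x hx => ?_)
        simp only [Set.indicator_of_mem hx.1]
        exact ofReal_le_sum_ofReal_coord_sub b hx.2
    _ = ∑ v, ∫⁻ x, B.indicator (fun x => ENNReal.ofReal (b.coord v x - s)) x :=
        lintegral_finsetSum' _ fun v _ => hind s v
    _ ≤ ∑ v, ENNReal.ofReal ((1 - s) ^ (n + 1)) *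
          ((∫⁻ y, B.indicator (fun x => ENNReal.ofReal (b.coord v x)) y) + volume (E v)) := by
        refine Finset.sum_le_sum fun v _ => ?_
        rw [lintegral_eq_lintegral_comp_homothety volume (b v) (sub_pos.2 hs),
          finrank_euclideanSpace_fin, pow_succ, ENNReal.ofReal_mul (by bound), mul_assoc]
        gcongr
        refine (lintegral_mono (indicator_comp_homothety_le b hs v (hE v))).trans_eq ?_
        rw [lintegral_const_mul' _ _ ENNReal.ofReal_ne_top, lintegral_add_left' (hind0 v),
          lintegral_indicator_one (hEm v)]
    _ = _ := by rw [← Finset.mul_sum, Finset.sum_add_distrib, hsum]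

/-! ### Choice of constants -/

/-- The averaging inequality is a strict contraction, with a gap proportional to `s`. -/
theorem one_sub_pow_succ_le {n : ℕ} {s η : ℝ} (hs : 0 < s) (hsn : n * (n + 1) * s ≤ 1 / 2)
    (hs1 : s ≤ 1 / 4) (hη : η ≤ s / 8) :
    (1 - s) ^ (n + 1) ≤ 1 - n * s - η - s / 8 := by
  have hn : (0 : ℝ) ≤ n := n.cast_nonneg
  have h1 : (1 - s) ^ (n + 1) * (1 + (n + 1) * s) ≤ 1 := by
    -- Bernoulli's inequality bounds `1 + (n + 1) s` by `(1 + s) ^ (n + 1)`.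
    calc (1 - s) ^ (n + 1) * (1 + (n + 1) * s) ≤ (1 - s) ^ (n + 1) * (1 + s) ^ (n + 1) := by
          have := one_add_mul_le_pow (a := s) (by linarith) (n + 1)
          push_cast at this
          have : 0 ≤ (1 - s) ^ (n + 1) := by apply pow_nonneg; linarith
          gcongr
      _ = (1 - s ^ 2) ^ (n + 1) := by rw [← mul_pow]; ring
      _ ≤ 1 := pow_le_one₀ (by nlinarith) (by nlinarith)
  have h2 : (n + 1) * s ≤ 1 := by
    rcases Nat.eq_zero_or_pos n with h | h
    · subst h; norm_num; linarith
    · have : (1 : ℝ) ≤ n := by exact_mod_cast h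
      nlinarith [mul_nonneg (sub_nonneg.2 this) (by positivity : 0 ≤ (n + 1) * s)]
  have hpos : 0 < 1 + (n + 1) * s := by positivity
  refine le_of_mul_le_mul_right (h1.trans ?_) hpos
  have h3 : (η + s / 8) * (1 + (n + 1) * s) ≤ s / 4 * 2 := by
    refine (mul_le_mul_of_nonneg_right (by linarith : η + s / 8 ≤ s / 4) hpos.le).trans ?_
    gcongr
    linarith
  nlinarith [mul_le_mul_of_nonneg_right hsn hs.le]

/-- Some power of `t` lies below `c` but not far below, and the exponent is at most `1 / c`. -/
theorem exists_pow_mem_Icc {t c : ℝ} (ht : 0 < t) (ht' : t ≤ 1 / 2) (hc : 0 < c) (hc' : c ≤ 1) :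
    ∃ k : ℕ, t ^ k ∈ Set.Icc (t * c) c ∧ k * c ≤ 1 := by
  obtain ⟨m, hm1, hm2⟩ := exists_nat_pow_near_of_lt_one hc hc' ht (by linarith)
  refine ⟨m + 1, ⟨?_, hm1.le⟩, ?_⟩
  · rw [pow_succ']
    gcongr
  · have h1 : ((m + 1 : ℕ) : ℝ) ≤ 2 ^ m := by exact_mod_cast Nat.lt_two_pow_self
    have h2 : t ^ m ≤ (1 / 2) ^ m := by gcongr
    calc ((m + 1 : ℕ) : ℝ) * c ≤ 2 ^ m * (1 / 2) ^ m := by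
          gcongr
          exact hm2.trans h2
      _ = 1 := by rw [← mul_pow]; norm_num

theorem constant_le {n : ℕ} (hn : 2 ≤ n) {t τ s : ℝ} {k : ℕ} (hτ : 0 < τ) (hτt : τ ≤ t)
    (hs : t * (2 * n * (n + 1) : ℝ)⁻¹ ≤ s) (hk : k * (2 * n * (n + 1) : ℝ)⁻¹ ≤ 1) :
    1 + (n + 1) * (k * 2 ^ n) ≤ s / 8 * ((4 * (n : ℝ)) ^ (5 * n) * τ⁻¹) := by
  have hn' : (2 : ℝ) ≤ n := by exact_mod_cast hn
  have ht : 0 < t := hτ.trans_le hτt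
  set c : ℝ := 2 * n * (n + 1) with hcdef
  have hc : 0 < c := by positivity
  -- `c ≤ 4 n²` gives `k ≤ 4 n²` and `s ≥ τ / (4 n²)`; everything else is crude.
  have hcn : c ≤ 4 * n ^ 2 := by nlinarith
  have hk' : (k : ℝ) ≤ 4 * n ^ 2 := by
    rw [← div_eq_mul_inv, div_le_one hc] at hk
    linarith
  have hL : 1 + (n + 1) * (k * 2 ^ n) ≤ 16 * n ^ 3 * (2 : ℝ) ^ n := by
    have h1 : (1 : ℝ) ≤ 2 ^ n := one_le_pow₀ (by norm_num)
    have h2 : (n + 1) * (k * (2 : ℝ) ^ n) ≤ (2 * n) * (4 * n ^ 2 * 2 ^ n) := by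
      gcongr
      linarith
    have h3 : (1 : ℝ) ≤ 8 * n ^ 3 * 2 ^ n := by
      have : (1 : ℝ) ≤ n ^ 3 := one_le_pow₀ (by linarith)
      nlinarith
    nlinarith
  have hP : 16 * (n : ℝ) ^ 3 * 2 ^ n * (32 * n ^ 2) ≤ (4 * (n : ℝ)) ^ (5 * n) := by
    calc 16 * (n : ℝ) ^ 3 * 2 ^ n * (32 * n ^ 2) ≤ (4 * (n : ℝ)) ^ 5 * (4 * (n : ℝ)) ^ n := by
          have : (2 : ℝ) ^ n ≤ (4 * (n : ℝ)) ^ n := by gcongr; linarith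
          calc 16 * (n : ℝ) ^ 3 * 2 ^ n * (32 * n ^ 2) = 512 * (n : ℝ) ^ 5 * 2 ^ n := by ring
            _ ≤ 1024 * (n : ℝ) ^ 5 * (4 * n) ^ n := by gcongr; norm_num
            _ = _ := by ring
      _ = (4 * (n : ℝ)) ^ (5 + n) := by rw [pow_add]
      _ ≤ _ := pow_le_pow_right₀ (by linarith) (by omega)
  have hs' : 1 / (32 * (n : ℝ) ^ 2) ≤ s / 8 * τ⁻¹ := by
    calc 1 / (32 * (n : ℝ) ^ 2) = τ * (4 * (n : ℝ) ^ 2)⁻¹ / 8 * τ⁻¹ := by field_simp; norm_num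
      _ ≤ t * c⁻¹ / 8 * τ⁻¹ := by gcongr
      _ ≤ _ := by gcongr
  calc 1 + (n + 1) * (k * 2 ^ n) ≤ 16 * n ^ 3 * (2 : ℝ) ^ n := hL
    _ ≤ 1 / (32 * (n : ℝ) ^ 2) * (4 * (n : ℝ)) ^ (5 * n) := by
        rw [one_div_mul_eq_div, le_div_iff₀ (by positivity)]
        exact hP
    _ ≤ s / 8 * τ⁻¹ * (4 * (n : ℝ)) ^ (5 * n) := by gcongr
    _ = _ := by ring

/-! ### The stability estimate -/

/-- The stability estimate for `t ≤ 1 / 2` and a simplex given by an affine basis, with the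
smallness of `|T \ A|` in the form needed to fill the part of `T` away from its boundary. -/
theorem measure_simplex_diff_le {n : ℕ} (hn : 2 ≤ n)
    (b : AffineBasis (Fin (n + 1)) ℝ (EuclideanSpace ℝ (Fin n)))
    {A : Set (EuclideanSpace ℝ (Fin n))} {t τ : ℝ} (hτ : 0 < τ) (hτt : τ ≤ t) (ht' : t ≤ 1 / 2)
    (hT : volume (convexHull ℝ (Set.range b)) = 1) (hA : NullMeasurableSet A volume)
    (hAT : A ⊆ convexHull ℝ (Set.range b)) (hv : ∀ i, b i ∈ A)
    (hB : 2 * volume (convexHull ℝ (Set.range b) \ A) <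
      ENNReal.ofReal ((t * (τ * (2 * n * (n + 1) : ℝ)⁻¹ / 8)) ^ n)) :
    volume (convexHull ℝ (Set.range b) \ A) ≤
      ENNReal.ofReal ((4 * (n : ℝ)) ^ (5 * n) * τ⁻¹) * sumsetExcess A t := by
  have hn' : (2 : ℝ) ≤ n := by exact_mod_cast hn
  have ht : 0 < t := hτ.trans_le hτt
  have hc : (0 : ℝ) < (2 * n * (n + 1) : ℝ)⁻¹ := by positivity
  have hc' : (2 * n * (n + 1) : ℝ)⁻¹ ≤ 1 / 4 := by
    rw [inv_le_comm₀ (by positivity) (by norm_num)]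
    nlinarith
  obtain ⟨k, ⟨hs1, hs2⟩, hk⟩ := exists_pow_mem_Icc ht ht' hc (hc'.trans (by norm_num))
  have hC := constant_le hn hτ hτt hs1 hk
  set s := t ^ k with hs
  set c := (2 * n * (n + 1) : ℝ)⁻¹ with hcdef
  set η := τ * c / 8 with hη
  have hs0 : 0 < s := by positivity
  have hη0 : 0 < η := by positivity
  have hηs : η ≤ s / 8 := by
    have : τ * c ≤ t * c := by gcongr
    linarith
  have hsn : n * (n + 1) * s ≤ 1 / 2 := by
    calc n * (n + 1) * s ≤ n * (n + 1) * c := by gcongr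
      _ = 1 / 2 := by rw [hcdef]; field_simp
  have hP := one_sub_pow_succ_le hs0 hsn (hs2.trans hc') hηs
  set T := convexHull ℝ (Set.range b) with hTdef
  -- `D(A;t)` need not be measurable: enclose its excess in a measurable set of the same measure.
  set G := toMeasurable volume (interpolatedSumset A t \ A) with hG
  have hε : volume G = sumsetExcess A t := measure_toMeasurable _
  have hE := measure_near_boundary_le b
    (E := fun v => ⋃ j ∈ Finset.range k, AffineMap.homothety (b v) (1 - t ^ (j + 1)) ⁻¹' G)
    (s := s) η (by linarith) hA
    (fun v => Finset.measurableSet_biUnion _ fun j _ =>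
      (AffineMap.homothety_continuous (b v) _).measurable (measurableSet_toMeasurable _ _))
    (fun v y hy hyA => by
      by_contra hcon
      refine hyA (homothety_mem_of_forall_notMem (hv v) hy (subset_toMeasurable volume _) k
        fun j hj hjG => hcon ?_)
      exact Set.mem_biUnion (Finset.mem_coe.2 (Finset.mem_range.2 hj)) hjG)
  -- Points of `T \ A` all of whose coordinates exceed `η` lie in `D(A;t) \ A`.
  have hcover : volume (T \ A) ≤
      volume ((T \ A) ∩ {x | ∃ j, b.coord j x ≤ η}) + sumsetExcess A t := by
    refine (measure_mono fun x hx => ?_).trans (measure_union_le _ _)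
    by_cases hxL : ∃ j, b.coord j x ≤ η
    · exact Or.inl ⟨hx, hxL⟩
    · push Not at hxL
      exact Or.inr ⟨mem_interpolatedSumset_of_lt_coord b ht ht' hη0 (by linarith) hT hB hxL, hx.2⟩
  have hεfin : sumsetExcess A t ≠ ∞ := by
    refine ne_top_of_le_ne_top (hT.trans_ne ENNReal.one_ne_top) (measure_mono ?_)
    exact Set.sdiff_subset.trans
      (interpolatedSumset_subset (convex_convexHull ℝ _) hAT ht.le (by linarith))
  have hBfin : volume (T \ A) ≠ ∞ :=
    ne_top_of_le_ne_top (hT.trans_ne ENNReal.one_ne_top) (measure_mono Set.sdiff_subset)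
  have hMfin : volume ((T \ A) ∩ {x | ∃ j, b.coord j x ≤ η}) ≠ ∞ :=
    ne_top_of_le_ne_top hBfin (measure_mono Set.inter_subset_left)
  have hE' := hE.trans (mul_le_mul_right (add_le_add_right (Finset.sum_le_sum fun v _ =>
    (measure_iUnion_preimage_homothety_le ht ht' (b v) G k).trans_eq (by rw [hε])) _) _)
  rw [Finset.sum_const, Finset.card_univ, Fintype.card_fin, nsmul_eq_mul] at hE'
  have hP0 : 0 ≤ (1 - s) ^ (n + 1) := pow_nonneg (by linarith) _
  have hP1 : (1 - s) ^ (n + 1) ≤ 1 := pow_le_one₀ (by linarith) (by linarith)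
  -- All measures are finite; the rest is linear arithmetic over `ℝ`, with the gap `s / 8` from `hP`.
  rw [← ENNReal.ofReal_toReal hBfin, ← ENNReal.ofReal_toReal hMfin,
    ← ENNReal.ofReal_toReal hεfin] at hE' hcover
  rw [← ENNReal.ofReal_toReal hBfin, ← ENNReal.ofReal_toReal hεfin]
  have hm := ENNReal.toReal_nonneg (a := volume (T \ A))
  have hM := ENNReal.toReal_nonneg (a := volume ((T \ A) ∩ {x | ∃ j, b.coord j x ≤ η}))
  have he := ENNReal.toReal_nonneg (a := sumsetExcess A t)
  generalize (volume (T \ A)).toReal = m at hE' hcover hm ⊢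
  generalize (volume ((T \ A) ∩ {x | ∃ j, b.coord j x ≤ η})).toReal = M at hE' hcover hM
  generalize (sumsetExcess A t).toReal = e at hE' hcover he ⊢
  have hZ0 : 0 ≤ 1 - n * s - η := by linarith
  rw [← ENNReal.ofReal_add hM he, ENNReal.ofReal_le_ofReal_iff (by positivity)] at hcover
  rw [← ENNReal.ofReal_mul hZ0, ← ENNReal.ofReal_natCast, ← ENNReal.ofReal_mul (by positivity),
    ← ENNReal.ofReal_mul (by positivity), ← ENNReal.ofReal_add hm (by positivity),
    ← ENNReal.ofReal_mul hP0,
    ENNReal.ofReal_le_ofReal_iff (by positivity)] at hE'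
  rw [← ENNReal.ofReal_mul (by positivity)]
  refine ENNReal.ofReal_le_ofReal (le_of_mul_le_mul_left ?_ (by positivity : 0 < s / 8))
  push_cast at hE'
  have hQ : 0 ≤ (n + 1) * (k * 2 ^ n * e) := by positivity
  have hZ1 : 1 - n * s - η ≤ 1 := by
    have : 0 ≤ n * s := by positivity
    linarith
  have h1 := mul_le_mul_of_nonneg_left hcover hZ0
  have h2 := mul_le_mul_of_nonneg_right hZ1 he
  have h3 := mul_le_mul_of_nonneg_right hP1 hQ
  have h4 := mul_le_mul_of_nonneg_right hP hm
  have h5 := mul_le_mul_of_nonneg_right hC he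
  linarith

theorem theorem2p1 (n : ℕ) (hn : 2 ≤ n) :
    ∃ δ₀ : ℝ → ℝ,
      (∀ τ : ℝ, 0 < τ → τ ≤ 1 / 2 → 0 < δ₀ τ ∧ δ₀ τ < 1) ∧
      ∀ τ : ℝ, 0 < τ → τ ≤ 1 / 2 →
      ∀ t ∈ Set.Icc τ (1 - τ),
      ∀ T : Affine.Simplex ℝ (EuclideanSpace ℝ (Fin n)) n,
        volume T.closedInterior = 1 →
      ∀ A : Set (EuclideanSpace ℝ (Fin n)),
        NullMeasurableSet A volume →
        A ⊆ T.closedInterior →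
        (∀ i, T.points i ∈ A) →
      ∀ δ : ℝ, 0 < δ → δ ≤ δ₀ τ →
        volume A = ENNReal.ofReal (1 - δ) →
        volume (T.closedInterior \ A) ≤
          ENNReal.ofReal ((4 * (n : ℝ)) ^ (5 * n) * τ⁻¹) * sumsetExcess A t := by
  have hn' : (2 : ℝ) ≤ n := by exact_mod_cast hn
  have hc : (0 : ℝ) < (2 * n * (n + 1) : ℝ)⁻¹ := by positivity
  have hc' : (2 * n * (n + 1) : ℝ)⁻¹ ≤ 1 := inv_le_one_of_one_le₀ (by nlinarith)
  have hlt : ∀ τ : ℝ, 0 < τ → τ ≤ 1 / 2 →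
      (τ * (τ * (2 * n * (n + 1) : ℝ)⁻¹ / 8)) ^ n / 3 < 1 := by
    intro τ hτ hτ'
    have h1 : τ * (2 * n * (n + 1) : ℝ)⁻¹ ≤ 1 := mul_le_one₀ (by linarith) hc.le hc'
    have h2 : (τ * (τ * (2 * n * (n + 1) : ℝ)⁻¹ / 8)) ^ n ≤ 1 :=
      pow_le_one₀ (by positivity)
        (mul_le_one₀ (by linarith) (by positivity) (by linarith))
    linarith
  refine ⟨fun τ => (τ * (τ * (2 * n * (n + 1) : ℝ)⁻¹ / 8)) ^ n / 3,
    fun τ hτ hτ' => ⟨by positivity, hlt τ hτ hτ'⟩, ?_⟩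
  intro τ hτ hτ' t ht T hT A hA hAT hv δ hδ hδ' hAδ
  let b : AffineBasis (Fin (n + 1)) ℝ (EuclideanSpace ℝ (Fin n)) :=
    ⟨T.points, T.independent,
      (T.independent.affineSpan_eq_top_iff_card_eq_finrank_add_one).2 (by simp)⟩
  have hbT : T.closedInterior = convexHull ℝ (Set.range b) :=
    T.convexHull_eq_closedInterior.symm
  have hdiff : volume (T.closedInterior \ A) = ENNReal.ofReal δ := by
    rw [measure_sdiff hAT hA (hAδ.trans_ne ENNReal.ofReal_ne_top), hT, hAδ,
      ← ENNReal.ofReal_one, ← ENNReal.ofReal_sub _ ?_]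
    · congr 1
      ring
    · linarith [hlt τ hτ hτ']
  have hsmall : ∀ u, τ ≤ u → 2 * volume (T.closedInterior \ A) <
      ENNReal.ofReal ((u * (τ * (2 * n * (n + 1) : ℝ)⁻¹ / 8)) ^ n) := by
    intro u hu
    have hpos : 0 < (τ * (τ * (2 * n * (n + 1) : ℝ)⁻¹ / 8)) ^ n := by positivity
    have hle : (τ * (τ * (2 * n * (n + 1) : ℝ)⁻¹ / 8)) ^ n ≤
      (u * (τ * (2 * n * (n + 1) : ℝ)⁻¹ / 8)) ^ n := by gcongr
    have h2 : (2 : ℝ≥0∞) = ENNReal.ofReal 2 := by simp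
    rw [hdiff, h2, ← ENNReal.ofReal_mul (by norm_num)]
    refine (ENNReal.ofReal_lt_ofReal_iff (hpos.trans_le hle)).2 ?_
    linarith
  rw [hbT] at hT hAT hsmall ⊢
  -- The sumset does not change under `t ↦ 1 - t`.
  rcases le_total t (1 / 2) with h | h
  · exact measure_simplex_diff_le hn b hτ ht.1 h hT hA hAT hv (hsmall t ht.1)
  · have ht2 : τ ≤ 1 - t := by linarith [ht.2]
    have := measure_simplex_diff_le hn b hτ ht2 (by linarith) hT hA hAT hv (hsmall _ ht2)
    rwa [sumsetExcess, interpolatedSumset_symm] at this
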